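/- Let $m, r \ge 0$ be integers and let $M$ be a Hausdorff smooth ($C^\infty$) manifold of dimension $m$, without boundary. For $p \in M$ let $\mathcal{F}_p$ be the $\mathbb{R}$-algebra of germs at $p$ of functions in $C^\infty(M)$ (two functions have the same germ if they agree on a neighbourhood of $p$), let $I_p \subset \mathcal{F}_p$ be the ideal of germs vanishing at $p$, and put $J^r_p = (I_p/I_p^{r+1})^*$, the dual of the real vector space $I_p/I_p^{r+1}$. For $\xi \in J_p^r$ and $f \in C^\infty(M)$ write $\xi(f)$ for the value of $\xi$ at the class of the germ of $f - f(p)$; this also makes sense for functions $f$ defined and smooth only near $p$, since each of them has the same germ at $p$ as a function in $C^\infty(M)$. For a commutative unital algebra $A$ over a commutative ring $k$, a $k$-linear map $D : A \to A$ is a differential operator of order $\le 0$ if it is multiplication by an element of $A$, and, for $s \ge 1$, a differential operator of order $\le s$ if for every $a \in A$ the map $b \mapsto D(ab) - aD(b)$ is a differential operator of order $\le s-1$. A derivation of order $\le r$ on $A$ is a differential operator of order $\le r$ that vanishes on $k$ (that is, on the image of $k$ in $A$). Then there is a smooth real vector bundle $J^r(M)$ over $M$, with fibre $J^r_p$ over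 each $p \in M$, such that: 1. every smooth chart $(U, (x^1, \dots, x^m))$ of $M$ gives a smooth local trivialization of $J^r(M)$ over $U$ whose fibre coordinates are the values $\xi(x^\alpha)$ at the monomials $x^\alpha = (x^1)^{\alpha_1} \cdots (x^m)^{\alpha_m}$ with $1 \le |\alpha| \le r$; 2. the space $\Gamma(J^r(M))$ of smooth sections of $J^r(M)$ is isomorphic, as a real vector space, to the space of derivations of order $\le r$ on the $\mathbb{R}$-algebra $C^\infty(M)$; such an isomorphism sends a section $\omega$ to the derivation $D$ given by $D(f)(p) = \omega(p)(f)$ for $f \in C^\infty(M)$ and $p \in M$. -/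

import Mathlib

open scoped Manifold ContDiff Topology Bundle

noncomputable section

/-! ### Differential operators and derivations of higher order on a commutative algebra -/

section Algebraic

variable (k A : Type*) [CommRing k] [CommRing A] [Algebra k A]

/-- `IsDiffOp k A r D`: the `k`-linear map `D : A → A` is a differential operator of order `≤ r`.
Order `0` means multiplication by an element of `A`; order `≤ r + 1` means that for every `a` the
map `b ↦ D (a * b) - a * D b` is a differential operator of order `≤ r`. -/
def IsDiffOp : ℕ → (A →ₗ[k] A) → Prop
  | 0, D => ∃ a : A, D = LinearMap.mulLeft k a
  | r + 1, D => ∀ a : A,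
      IsDiffOp r (D ∘ₗ LinearMap.mulLeft k a - LinearMap.mulLeft k a ∘ₗ D)

variable {k A}

theorem IsDiffOp.zero (r : ℕ) : IsDiffOp k A r 0 := by
  induction r with
  | zero => exact ⟨0, by simp⟩
  | succ r ih => intro a; simpa using ih

theorem IsDiffOp.add {r : ℕ} {D D' : A →ₗ[k] A} (h : IsDiffOp k A r D)
    (h' : IsDiffOp k A r D') : IsDiffOp k A r (D + D') := by
  induction r generalizing D D' with
  | zero =>
    obtain ⟨a, rfl⟩ := h
    obtain ⟨b, rfl⟩ := h'
    exact ⟨a + b, by ext x; simp [add_mul]⟩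
  | succ r ih =>
    intro a
    have := ih (h a) (h' a)
    convert this using 1
    ext x
    simp only [LinearMap.sub_apply, LinearMap.comp_apply, LinearMap.add_apply,
      LinearMap.mulLeft_apply]
    ring

theorem IsDiffOp.smul {r : ℕ} {D : A →ₗ[k] A} (c : k) (h : IsDiffOp k A r D) :
    IsDiffOp k A r (c • D) := by
  induction r generalizing D with
  | zero =>
    obtain ⟨a, rfl⟩ := h
    exact ⟨c • a, by ext x; simp⟩
  | succ r ih =>
    intro a
    have := ih (h a)
    convert this using 1
    ext x
    simp [smul_sub]

variable (k A)

/-- The `k`-module of derivations of order `≤ r` on `A`: the differential operators of order `≤ r`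
that vanish on (the image in `A` of) the scalars `k`. -/
def higherDerivations (r : ℕ) : Submodule k (A →ₗ[k] A) where
  carrier := {D | IsDiffOp k A r D ∧ ∀ c : k, D (algebraMap k A c) = 0}
  zero_mem' := ⟨IsDiffOp.zero r, fun _ => rfl⟩
  add_mem' := fun h h' => ⟨h.1.add h'.1, fun c => by simp [h.2 c, h'.2 c]⟩
  smul_mem' := fun c _ h => ⟨h.1.smul c, fun c' => by simp [h.2 c']⟩

end Algebraic

/-! ### Germs of smooth functions and the fibres `(I_p / I_p ^ (r + 1))^*` -/

section Germs

variable (m : ℕ) {M : Type*} [TopologicalSpace M] [ChartedSpace (EuclideanSpace ℝ (Fin m)) M]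

/-- The ideal of smooth functions on `M` that vanish on some neighbourhood of `p`. -/
def vanishNearIdeal (p : M) : Ideal C^∞⟮𝓡 m, M; ℝ⟯ where
  carrier := {f | ∀ᶠ q in 𝓝 p, f q = 0}
  zero_mem' := Filter.Eventually.of_forall fun _ => rfl
  add_mem' := fun {f g} hf hg => by
    filter_upwards [hf, hg] with q h1 h2
    simp [h1, h2]
  smul_mem' := fun c f hf => by
    filter_upwards [hf] with q h
    simp [h]

/-- The `ℝ`-algebra `F_p` of germs at `p` of smooth functions on `M`: two functions have the same
germ if and only if they agree on a neighbourhood of `p`. -/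
abbrev SmoothGerm (p : M) : Type _ := C^∞⟮𝓡 m, M; ℝ⟯ ⧸ vanishNearIdeal m p

/-- The value of a germ at its base point. -/
def SmoothGerm.value (p : M) : SmoothGerm m p →+* ℝ :=
  Ideal.Quotient.lift (vanishNearIdeal m p) (ContMDiffMap.evalRingHom p)
    fun f hf => show f p = 0 from Filter.Eventually.self_of_nhds (p := fun q => f q = 0) hf

/-- The ideal `I_p` of germs at `p` that vanish at `p`. -/
def germIdeal (p : M) : Ideal (SmoothGerm m p) := RingHom.ker (SmoothGerm.value m p)

/-- The real vector space `I_p / I_p ^ (r + 1)`. -/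
abbrev CoJet (r : ℕ) (p : M) : Type _ :=
  ↥(germIdeal m p) ⧸ (germIdeal m p ^ (r + 1)).submoduleOf (germIdeal m p)

/-- The class in `I_p / I_p ^ (r + 1)` of the germ at `p` of `f - f p`. -/
def coJetClass (r : ℕ) (p : M) (f : C^∞⟮𝓡 m, M; ℝ⟯) : CoJet m r p :=
  Submodule.Quotient.mk
    ⟨Ideal.Quotient.mk (vanishNearIdeal m p) (f - algebraMap ℝ C^∞⟮𝓡 m, M; ℝ⟯ (f p)),
      by exact (sub_self (f p) : f p - f p = 0)⟩

/-- The fibre `J_p^r = (I_p / I_p ^ (r + 1))^*`. -/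
def JetFiber (r : ℕ) (p : M) : Type _ := Module.Dual ℝ (CoJet m r p)

instance (r : ℕ) (p : M) : AddCommGroup (JetFiber m r p) :=
  inferInstanceAs (AddCommGroup (Module.Dual ℝ (CoJet m r p)))

instance (r : ℕ) (p : M) : Module ℝ (JetFiber m r p) :=
  inferInstanceAs (Module ℝ (Module.Dual ℝ (CoJet m r p)))

variable {m}

/-- The action of `ξ ∈ J_p^r` on a smooth function `f`: `ξ` evaluated at the class of `f - f p`. -/
def JetFiber.act {r : ℕ} {p : M} (ξ : JetFiber m r p) (f : C^∞⟮𝓡 m, M; ℝ⟯) : ℝ :=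
  (show Module.Dual ℝ (CoJet m r p) from ξ) (coJetClass m r p f)

end Germs

/-- The exponents `α` of the monomials in `m` variables of degree `1 ≤ |α| ≤ r`. (The bound
`α i ≤ r` built into the type follows from `|α| ≤ r`.) -/
abbrev JetIndex (m r : ℕ) : Type :=
  {α : Fin m → Fin (r + 1) // 1 ≤ ∑ i, (α i : ℕ) ∧ ∑ i, (α i : ℕ) ≤ r}

/-- The model fibre `ℝ^K`, where `K` is the number of monomials of degree between `1` and `r`. -/
abbrev JetModel (m r : ℕ) : Type := JetIndex m r → ℝ

end

/-! ### Parametric integrals and Hadamard's lemma with parameters -/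

section Analysis

/-! Let 𝔪_p be the ideal of global smooth functions vanishing at p (`pointIdeal`). Bump functions
put every function that vanishes near p into all powers of 𝔪_p, so germs can be avoided: a jet at p
amounts to a linear functional on C^∞(M) that kills the constants and 𝔪_p^(r+1)
(`exists_jetFiber_act_eq`).

An operator D is a differential operator of order ≤ r exactly when Df(p) = 0 for all p and all f ∈
𝔪_p^(r+1) (`isDiffOp_of_forall_mem_pow`, `IsDiffOp.apply_eq_zero`). Hence a derivation of order ≤ r
is a family of jets ξ_p such that p ↦ ξ_p(f) is smooth for every f. What remains is a bundle whose
smooth sections are these families.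

For this the monomials x^α, 1 ≤ |α| ≤ r, must form a basis of I_q/I_q^(r+1) at each q in a chart,
with expansion coefficients that are locally smooth in q. Hadamard's lemma, iterated with the base
point as a parameter, gives the expansion and the smoothness (`exists_taylor_chart`). Independence
is tested on lines, where a polynomial of degree ≤ r that is O(t^(r+1)) at 0 must vanish. The smooth
coefficients are the entries of the transition matrices (`contMDiffOn_jetCoordChange`) and also
yield the smoothness criterion `contMDiff_jetSection_iff`. -/

theorem hasFDerivAt_intervalIntegral_of_contDiff {H G : Type*} [NormedAddCommGroup H]
    [NormedSpace ℝ H] [FiniteDimensional ℝ H] [NormedAddCommGroup G] [NormedSpace ℝ G]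
    {F : H × ℝ → G} (hF : ContDiff ℝ 1 F) (a b : ℝ) (x₀ : H) :
    HasFDerivAt (fun x => ∫ t in a..b, F (x, t))
      (∫ t in a..b, (fderiv ℝ F (x₀, t)).comp (ContinuousLinearMap.inl ℝ H ℝ)) x₀ := by
  have hF' : Continuous fun z : H × ℝ =>
      (fderiv ℝ F z).comp (ContinuousLinearMap.inl ℝ H ℝ) :=
    (hF.continuous_fderiv one_ne_zero).clm_comp continuous_const
  have hcont : ∀ x, Continuous fun t : ℝ => F (x, t) := fun x =>
    hF.continuous.comp (by fun_prop)
  obtain ⟨C, hC⟩ := ((isCompact_closedBall x₀ (1 : ℝ)).prod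
    (isCompact_uIcc (a := a) (b := b))).exists_bound_of_continuousOn hF'.continuousOn
  refine intervalIntegral.hasFDerivAt_integral_of_dominated_of_fderiv_le
    (F' := fun x t => (fderiv ℝ F (x, t)).comp (ContinuousLinearMap.inl ℝ H ℝ))
    (bound := fun _ => C) (Metric.closedBall_mem_nhds x₀ one_pos)
    (Filter.Eventually.of_forall fun x => (hcont x).aestronglyMeasurable)
    ((hcont x₀).intervalIntegrable a b) ?_ ?_ (by simp) ?_
  · exact (hF'.comp (by fun_prop : Continuous fun t : ℝ => (x₀, t))).aestronglyMeasurable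
  · exact Filter.Eventually.of_forall fun t ht x hx =>
      hC (x, t) ⟨hx, Set.uIoc_subset_uIcc ht⟩
  · refine Filter.Eventually.of_forall fun t _ x _ => ?_
    exact ((hF.differentiable one_ne_zero (x, t)).hasFDerivAt).comp x
      (hasFDerivAt_prodMk_left x t)

theorem contDiff_intervalIntegral {H : Type*} [NormedAddCommGroup H] [NormedSpace ℝ H]
    [FiniteDimensional ℝ H] (a b : ℝ) {F : H × ℝ → ℝ} (hF : ContDiff ℝ ∞ F) :
    ContDiff ℝ ∞ fun x => ∫ t in a..b, F (x, t) := by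
  rw [contDiff_infty]
  intro n
  induction n generalizing F with
  | zero =>
    exact contDiff_zero.2 (intervalIntegral.continuous_parametric_intervalIntegral_of_continuous'
      (f := fun x t => F (x, t)) hF.continuous a b)
  | succ n ih =>
    have hF' : ContDiff ℝ ∞ fun z : H × ℝ =>
        (fderiv ℝ F z).comp (ContinuousLinearMap.inl ℝ H ℝ) :=
      (hF.fderiv_right (by simp)).clm_comp contDiff_const
    push_cast
    refine contDiff_succ_iff_hasFDerivAt.2 ⟨_, ?_, fun x =>
      hasFDerivAt_intervalIntegral_of_contDiff (hF.of_le (by norm_cast)) a b x⟩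
    -- Testing the derivative on a fixed `v` makes the integrand real-valued again, so the induction
    -- hypothesis applies.
    refine contDiff_clm_apply_iff.2 fun v => ?_
    have := ih (hF'.clm_apply (contDiff_const (c := v)))
    convert this using 2 with x
    refine (ContinuousLinearMap.intervalIntegral_apply ?_ v)
    exact (hF'.continuous.comp (by fun_prop : Continuous fun t : ℝ => (x, t))).intervalIntegrable
      a b

/-- Hadamard's lemma with parameters. -/
theorem exists_contDiff_eq_add_sum_mul {m : ℕ}
    {F : EuclideanSpace ℝ (Fin m) × EuclideanSpace ℝ (Fin m) → ℝ} (hF : ContDiff ℝ ∞ F) :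
    ∃ G : Fin m → EuclideanSpace ℝ (Fin m) × EuclideanSpace ℝ (Fin m) → ℝ,
      (∀ i, ContDiff ℝ ∞ (G i)) ∧
        ∀ q x, F (q, x) = F (q, q) + ∑ i, (x i - q i) * G i (q, x) := by
  -- For a pair (q, x) the first slot stays at the parameter q while the second runs along the
  -- segment from q to x.
  let γ : (EuclideanSpace ℝ (Fin m) × EuclideanSpace ℝ (Fin m)) × ℝ →
      EuclideanSpace ℝ (Fin m) × EuclideanSpace ℝ (Fin m) :=
    fun z => (z.1.1, z.1.1 + z.2 • (z.1.2 - z.1.1))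
  have hγ : ContDiff ℝ ∞ γ := by fun_prop
  have hd : ContDiff ℝ ∞ fun z => fderiv ℝ F (γ z) := (hF.fderiv_right (by simp)).comp hγ
  refine ⟨fun i z => ∫ t in (0 : ℝ)..1, fderiv ℝ F (γ (z, t)) (0, EuclideanSpace.single i 1),
    fun i => contDiff_intervalIntegral 0 1
      (F := fun z => fderiv ℝ F (γ z) (0, EuclideanSpace.single i 1))
      (hd.clm_apply contDiff_const), fun q x => ?_⟩
  have hderiv : ∀ t ∈ Set.uIcc (0 : ℝ) 1, HasDerivAt (fun t => F (γ ((q, x), t)))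
      (fderiv ℝ F (γ ((q, x), t)) (0, x - q)) t := by
    intro t _
    have h1 : HasDerivAt (fun t : ℝ => γ ((q, x), t)) (0, x - q) t := by
      refine (hasDerivAt_const t q).prodMk ?_
      simpa using ((hasDerivAt_id t).smul_const (x - q)).const_add q
    exact ((hF.differentiable (by simp) _).hasFDerivAt).comp_hasDerivAt t h1
  have hcont : ∀ v, Continuous fun t : ℝ => fderiv ℝ F (γ ((q, x), t)) v := fun v =>
    (hd.continuous.clm_apply continuous_const).comp
      (by fun_prop : Continuous fun t : ℝ => ((q, x), t))
  have hftc := intervalIntegral.integral_eq_sub_of_hasDerivAt hderiv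
    ((hcont _).intervalIntegrable 0 1)
  have hsum : ∀ t : ℝ, fderiv ℝ F (γ ((q, x), t)) (0, x - q) =
      ∑ i, (x i - q i) * fderiv ℝ F (γ ((q, x), t)) (0, EuclideanSpace.single i 1) := by
    intro t
    have : ((0, x - q) : EuclideanSpace ℝ (Fin m) × EuclideanSpace ℝ (Fin m)) =
        ∑ i, (x i - q i) • ((0, EuclideanSpace.single i 1) :
          EuclideanSpace ℝ (Fin m) × EuclideanSpace ℝ (Fin m)) := by
      refine Prod.ext (by simp [Prod.fst_sum]) ?_
      ext j
      simp [Prod.snd_sum, Pi.single_apply]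
    rw [this, map_sum]
    simp only [map_smul, smul_eq_mul]
  simp only [hsum] at hftc
  rw [intervalIntegral.integral_finsetSum
    fun i _ => ((hcont _).const_mul _).intervalIntegrable 0 1] at hftc
  simp only [intervalIntegral.integral_const_mul] at hftc
  rw [hftc]
  simp [γ]

/-- A function that is smooth near `p` has the same germ at `p` as a global smooth function. -/
theorem exists_contMDiffMap_eventuallyEq {m : ℕ} {M : Type*} [TopologicalSpace M] [T2Space M]
    [ChartedSpace (EuclideanSpace ℝ (Fin m)) M] [IsManifold (𝓡 m) ∞ M] {p : M} {g : M → ℝ}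
    (hg : ∀ᶠ q in 𝓝 p, ContMDiffAt (𝓡 m) 𝓘(ℝ, ℝ) ∞ g q) :
    ∃ f : C^∞⟮𝓡 m, M; ℝ⟯, ∀ᶠ q in 𝓝 p, f q = g q := by
  obtain ⟨χ, hχ, -⟩ := (SmoothBumpFunction.nhds_basis_support (I := 𝓡 m) hg).mem_iff.1
    Filter.univ_mem
  refine ⟨⟨fun q => χ q • g q, contMDiff_of_tsupport fun q hq => ?_⟩, ?_⟩
  · exact χ.contMDiffAt.smul (hχ (tsupport_smul_subset_left _ _ hq))
  · filter_upwards [χ.eventuallyEq_one] with q hq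
    simp only [ContMDiffMap.coeFn_mk, hq, Pi.one_apply, one_smul]

end Analysis

/-! ### Jets as functionals on smooth functions -/

section Jets

variable {m : ℕ} {M : Type*} [TopologicalSpace M] [ChartedSpace (EuclideanSpace ℝ (Fin m)) M]

variable (m) in
/-- The ideal of smooth functions on `M` that vanish at `p`. -/
noncomputable def pointIdeal (p : M) : Ideal C^∞⟮𝓡 m, M; ℝ⟯ := RingHom.ker (ContMDiffMap.evalRingHom p)

theorem mem_pointIdeal {p : M} {f : C^∞⟮𝓡 m, M; ℝ⟯} : f ∈ pointIdeal m p ↔ f p = 0 := Iff.rfl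

theorem sub_const_mem_pointIdeal (p : M) (f : C^∞⟮𝓡 m, M; ℝ⟯) :
    f - algebraMap ℝ C^∞⟮𝓡 m, M; ℝ⟯ (f p) ∈ pointIdeal m p :=
  sub_self (f p)

theorem map_pointIdeal (p : M) :
    (pointIdeal m p).map (Ideal.Quotient.mk (vanishNearIdeal m p)) = germIdeal m p := by
  ext x
  rw [Ideal.mem_map_iff_of_surjective _ Ideal.Quotient.mk_surjective]
  constructor
  · rintro ⟨f, hf, rfl⟩
    exact hf
  · intro hx
    obtain ⟨f, rfl⟩ := Ideal.Quotient.mk_surjective x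
    exact ⟨f, hx, rfl⟩

section Bump

variable [T2Space M] [IsManifold (𝓡 m) ∞ M]

/-- With a bump function χ at p supported where f = 0, one has f = f · (1 - χ)^n, and 1 - χ vanishes
at p. -/
theorem vanishNearIdeal_le_pow (p : M) (n : ℕ) : vanishNearIdeal m p ≤ pointIdeal m p ^ n := by
  intro f hf
  obtain ⟨χ, hχ, -⟩ := (SmoothBumpFunction.nhds_basis_support (I := 𝓡 m)
    (s := {q | f q = 0}) hf).mem_iff.1 Filter.univ_mem
  let g : C^∞⟮𝓡 m, M; ℝ⟯ := 1 - ⟨χ, χ.contMDiff⟩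
  have hg : g ∈ pointIdeal m p := by
    change 1 - χ p = 0
    rw [χ.eq_one, sub_self]
  have hfg : f = f * g ^ n := by
    ext q
    change f q = f q * (1 - χ q) ^ n
    by_cases hq : f q = 0
    · simp [hq]
    · have : χ q = 0 := by
        by_contra h
        exact hq (hχ (subset_tsupport _ h))
      simp [this]
  rw [hfg]
  exact Ideal.mul_mem_left _ _ (Ideal.pow_mem_pow hg n)

/-- This replaces powers of the germ ideal by powers of an ideal of global functions. -/
theorem mk_mem_germIdeal_pow {p : M} {n : ℕ} {f : C^∞⟮𝓡 m, M; ℝ⟯} :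
    Ideal.Quotient.mk (vanishNearIdeal m p) f ∈ germIdeal m p ^ n ↔ f ∈ pointIdeal m p ^ n := by
  rw [← map_pointIdeal, ← Ideal.map_pow]
  refine ⟨fun h => ?_, Ideal.mem_map_of_mem _⟩
  obtain ⟨g, hg, hfg⟩ := (Ideal.mem_map_iff_of_surjective _ Ideal.Quotient.mk_surjective).1 h
  rw [← sub_sub_cancel g f]
  exact Ideal.sub_mem _ hg (vanishNearIdeal_le_pow p n (Ideal.Quotient.eq.1 hfg))

end Bump

variable (m) in
/-- The linear map that sends `f` to the class of the germ of `f - f p`. -/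
noncomputable def coJetLinear (r : ℕ) (p : M) : C^∞⟮𝓡 m, M; ℝ⟯ →ₗ[ℝ] CoJet m r p where
  toFun := coJetClass m r p
  map_add' f g := by
    refine congrArg Submodule.Quotient.mk (Subtype.ext ?_)
    change Ideal.Quotient.mk _ _ = Ideal.Quotient.mk _ _ + Ideal.Quotient.mk _ _
    rw [← map_add]
    congr 1
    ext q
    change f q + g q - (f p + g p) = f q - f p + (g q - g p)
    ring
  map_smul' c f := by
    refine congrArg Submodule.Quotient.mk (Subtype.ext ?_)
    change Ideal.Quotient.mk _ _ = Ideal.Quotient.mk _ (c • _)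
    congr 1
    ext q
    change c * f q - c * f p = c * (f q - f p)
    ring

theorem coJetLinear_surjective (r : ℕ) (p : M) : Function.Surjective (coJetLinear m r p) := by
  intro x
  obtain ⟨⟨y, hy⟩, rfl⟩ := Submodule.Quotient.mk_surjective _ x
  obtain ⟨f, rfl⟩ := Ideal.Quotient.mk_surjective y
  have hf : f p = 0 := hy
  refine ⟨f, congrArg Submodule.Quotient.mk (Subtype.ext ?_)⟩
  simp [hf]

/-- The linear functional on smooth functions given by a jet. -/
noncomputable def JetFiber.toDual {r : ℕ} {p : M} (ξ : JetFiber m r p) : C^∞⟮𝓡 m, M; ℝ⟯ →ₗ[ℝ] ℝ :=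
  LinearMap.comp (show Module.Dual ℝ (CoJet m r p) from ξ) (coJetLinear m r p)

theorem JetFiber.toDual_apply {r : ℕ} {p : M} (ξ : JetFiber m r p) (f : C^∞⟮𝓡 m, M; ℝ⟯) :
    ξ.toDual f = ξ.act f := rfl

theorem JetFiber.ext_act {r : ℕ} {p : M} {ξ η : JetFiber m r p}
    (h : ∀ f : C^∞⟮𝓡 m, M; ℝ⟯, ξ.act f = η.act f) : ξ = η := by
  refine LinearMap.ext (f := show Module.Dual ℝ (CoJet m r p) from ξ)
    (g := show Module.Dual ℝ (CoJet m r p) from η) fun x => ?_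
  obtain ⟨f, rfl⟩ := coJetLinear_surjective r p x
  exact h f

theorem JetFiber.add_act {r : ℕ} {p : M} (ξ η : JetFiber m r p) (f : C^∞⟮𝓡 m, M; ℝ⟯) :
    (ξ + η).act f = ξ.act f + η.act f := rfl

theorem JetFiber.smul_act {r : ℕ} {p : M} (c : ℝ) (ξ : JetFiber m r p) (f : C^∞⟮𝓡 m, M; ℝ⟯) :
    (c • ξ).act f = c * ξ.act f := rfl

variable [T2Space M] [IsManifold (𝓡 m) ∞ M]

theorem coJetLinear_eq_zero_iff {r : ℕ} {p : M} {f : C^∞⟮𝓡 m, M; ℝ⟯} :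
    coJetLinear m r p f = 0 ↔
      f - algebraMap ℝ C^∞⟮𝓡 m, M; ℝ⟯ (f p) ∈ pointIdeal m p ^ (r + 1) := by
  rw [← mk_mem_germIdeal_pow]
  exact (Submodule.Quotient.mk_eq_zero _).trans Submodule.mem_comap

theorem coJetLinear_eq_zero {r : ℕ} {p : M} {f : C^∞⟮𝓡 m, M; ℝ⟯} (c : ℝ)
    (h : f - algebraMap ℝ C^∞⟮𝓡 m, M; ℝ⟯ c ∈ pointIdeal m p ^ (r + 1)) :
    coJetLinear m r p f = 0 := by
  have hc : f p - c = 0 := Ideal.pow_le_self r.succ_ne_zero h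
  rw [coJetLinear_eq_zero_iff, sub_eq_zero.1 hc]
  exact h

theorem coJetLinear_congr {r : ℕ} {p : M} {f g : C^∞⟮𝓡 m, M; ℝ⟯}
    (h : ∀ᶠ q in 𝓝 p, f q = g q) : coJetLinear m r p f = coJetLinear m r p g := by
  rw [← sub_eq_zero, ← map_sub]
  refine coJetLinear_eq_zero 0 ?_
  rw [map_zero, sub_zero]
  refine vanishNearIdeal_le_pow p _ ?_
  filter_upwards [h] with q hq
  exact sub_eq_zero.2 hq

theorem JetFiber.act_congr {r : ℕ} {p : M} (ξ : JetFiber m r p) {f g : C^∞⟮𝓡 m, M; ℝ⟯}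
    (h : ∀ᶠ q in 𝓝 p, f q = g q) : ξ.act f = ξ.act g :=
  congrArg (show Module.Dual ℝ (CoJet m r p) from ξ) (coJetLinear_congr h)

theorem JetFiber.act_algebraMap {r : ℕ} {p : M} (ξ : JetFiber m r p) (c : ℝ) :
    ξ.act (algebraMap ℝ C^∞⟮𝓡 m, M; ℝ⟯ c) = 0 := by
  have : coJetLinear m r p (algebraMap ℝ C^∞⟮𝓡 m, M; ℝ⟯ c) = 0 :=
    coJetLinear_eq_zero c (by simp)
  rw [← ξ.toDual_apply, JetFiber.toDual, LinearMap.comp_apply, this, map_zero]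

theorem JetFiber.act_eq_zero {r : ℕ} {p : M} (ξ : JetFiber m r p) {f : C^∞⟮𝓡 m, M; ℝ⟯}
    (hf : f ∈ pointIdeal m p ^ (r + 1)) : ξ.act f = 0 := by
  have : coJetLinear m r p f = 0 := coJetLinear_eq_zero 0 (by simpa using hf)
  rw [← ξ.toDual_apply, JetFiber.toDual, LinearMap.comp_apply, this, map_zero]

/-- A functional on smooth functions that kills the constants and the `(r + 1)`-st power of the
ideal of a point is given by a jet. -/
theorem exists_jetFiber_act_eq {r : ℕ} {p : M} (L : C^∞⟮𝓡 m, M; ℝ⟯ →ₗ[ℝ] ℝ)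
    (hc : ∀ c : ℝ, L (algebraMap ℝ C^∞⟮𝓡 m, M; ℝ⟯ c) = 0)
    (hL : ∀ f ∈ pointIdeal m p ^ (r + 1), L f = 0) :
    ∃ ξ : JetFiber m r p, ∀ f, ξ.act f = L f := by
  have hker : LinearMap.ker (coJetLinear m r p) ≤ LinearMap.ker L := by
    intro f hf
    have := hL _ (coJetLinear_eq_zero_iff.1 (LinearMap.mem_ker.1 hf))
    rwa [map_sub, hc, sub_zero] at this
  refine ⟨show Module.Dual ℝ (CoJet m r p) from (LinearMap.ker (coJetLinear m r p)).liftQ L hker ∘ₗ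
    ((coJetLinear m r p).quotKerEquivOfSurjective (coJetLinear_surjective r p)).symm.toLinearMap,
    fun f => ?_⟩
  change (LinearMap.ker (coJetLinear m r p)).liftQ L hker
    (((coJetLinear m r p).quotKerEquivOfSurjective (coJetLinear_surjective r p)).symm
      (coJetLinear m r p f)) = L f
  have : ((coJetLinear m r p).quotKerEquivOfSurjective (coJetLinear_surjective r p)).symm
      (coJetLinear m r p f) = Submodule.Quotient.mk f := by
    rw [LinearEquiv.symm_apply_eq]
    rfl
  rw [this]
  rfl

end Jets

/-! ### Differential operators and powers of point ideals -/

section DiffOp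

variable {m : ℕ} {M : Type*} [TopologicalSpace M] [ChartedSpace (EuclideanSpace ℝ (Fin m)) M]

/-- The commutator of D with a, applied to f and evaluated at p, is D((a - a(p)) f)(p), and the
factor a - a(p) raises the power of the ideal by one. For r = 0, applying D to f - f(p) shows that D
is multiplication by D(1). -/
theorem isDiffOp_of_forall_mem_pow {r : ℕ} {D : C^∞⟮𝓡 m, M; ℝ⟯ →ₗ[ℝ] C^∞⟮𝓡 m, M; ℝ⟯}
    (hD : ∀ p : M, ∀ f ∈ pointIdeal m p ^ (r + 1), D f p = 0) :
    IsDiffOp ℝ C^∞⟮𝓡 m, M; ℝ⟯ r D := by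
  induction r generalizing D with
  | zero =>
    refine ⟨D 1, LinearMap.ext fun f => ContMDiffMap.ext fun p => ?_⟩
    have h := hD p (f - algebraMap ℝ C^∞⟮𝓡 m, M; ℝ⟯ (f p))
      (by simpa using sub_const_mem_pointIdeal p f)
    rw [Algebra.algebraMap_eq_smul_one, map_sub, map_smul] at h
    have h' : D f p - f p * D 1 p = 0 := h
    change D f p = D 1 p * f p
    linarith
  | succ r ih =>
    intro a
    refine ih fun p f hf => ?_
    have h := hD p _ (by
      rw [pow_succ']
      exact Ideal.mul_mem_mul (sub_const_mem_pointIdeal p a) hf)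
    rw [Algebra.algebraMap_eq_smul_one, sub_mul, smul_mul_assoc, one_mul, map_sub, map_smul] at h
    exact h

/-- If a vanishes at p, then D(ab)(p) is the value at p of the commutator of D with a, applied to b;
this has lower order. -/
theorem IsDiffOp.apply_eq_zero {r : ℕ} {D : C^∞⟮𝓡 m, M; ℝ⟯ →ₗ[ℝ] C^∞⟮𝓡 m, M; ℝ⟯}
    (hD : IsDiffOp ℝ C^∞⟮𝓡 m, M; ℝ⟯ r D) (p : M) {f : C^∞⟮𝓡 m, M; ℝ⟯}
    (hf : f ∈ pointIdeal m p ^ (r + 1)) : D f p = 0 := by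
  induction r generalizing D f with
  | zero =>
    obtain ⟨a, rfl⟩ := hD
    have : f p = 0 := by simpa [mem_pointIdeal] using hf
    change a p * f p = 0
    rw [this, mul_zero]
  | succ r ih =>
    rw [pow_succ'] at hf
    refine Submodule.mul_induction_on hf (fun a ha b hb => ?_) fun a b ha hb => ?_
    · have h : D (a * b) p - a p * D b p = 0 := ih (hD a) hb
      rwa [mem_pointIdeal.1 ha, zero_mul, sub_zero] at h
    · rw [map_add]
      change D a p + D b p = 0
      rw [ha, hb, add_zero]

end DiffOp

/-! ### Taylor expansion with smoothly varying coefficients -/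

section Taylor

variable {m : ℕ}

/-- The exponent of a monomial as a finitely supported function. -/
noncomputable def JetIndex.toFinsupp {r : ℕ} (α : JetIndex m r) : Fin m →₀ ℕ :=
  Finsupp.equivFunOnFinite.symm fun i => (α.1 i : ℕ)

theorem JetIndex.toFinsupp_injective {r : ℕ} :
    Function.Injective (JetIndex.toFinsupp : JetIndex m r → Fin m →₀ ℕ) := by
  intro α β h
  refine Subtype.ext (funext fun i => Fin.ext ?_)
  exact DFunLike.congr_fun h i

theorem JetIndex.degree_toFinsupp {r : ℕ} (α : JetIndex m r) :
    α.toFinsupp.degree = ∑ i, (α.1 i : ℕ) := by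
  rw [Finsupp.degree_eq_sum]
  rfl

theorem JetIndex.toFinsupp_ne_zero {r : ℕ} (α : JetIndex m r) : α.toFinsupp ≠ 0 := by
  intro h
  have h1 := α.2.1
  rw [← α.degree_toFinsupp, h, map_zero] at h1
  omega

theorem JetIndex.exists_toFinsupp_eq {r : ℕ} {d : Fin m →₀ ℕ} (hd : d ≠ 0)
    (hr : d.degree ≤ r) : ∃ α : JetIndex m r, α.toFinsupp = d := by
  have hle : ∀ i, d i < r + 1 := fun i => Nat.lt_succ_of_le ((Finsupp.le_degree i d).trans hr)
  have h1 : 1 ≤ d.degree := Nat.one_le_iff_ne_zero.2 fun h => hd ((Finsupp.degree_eq_zero_iff d).1 h)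
  rw [Finsupp.degree_eq_sum] at h1 hr
  refine ⟨⟨fun i => ⟨d i, hle i⟩, h1, hr⟩, ?_⟩
  ext i
  rfl

theorem JetIndex.prod_toFinsupp {r : ℕ} (α : JetIndex m r) {R : Type*} [CommSemiring R]
    (X : Fin m → R) : (α.toFinsupp.prod fun i k => X i ^ k) = ∏ i, X i ^ (α.1 i : ℕ) :=
  Finsupp.prod_fintype _ _ fun _ => pow_zero _

theorem MvPolynomial.eq_C_add_sum_jetIndex {r : ℕ} {P : MvPolynomial (Fin m) ℝ}
    (hP : P.totalDegree ≤ r) :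
    P = C (P.coeff 0) + ∑ α : JetIndex m r, monomial α.toFinsupp (P.coeff α.toFinsupp) := by
  classical
  ext d
  rw [coeff_add, coeff_sum, coeff_C]
  simp only [coeff_monomial]
  by_cases hd : d = 0
  · subst hd
    rw [Finset.sum_eq_zero fun α _ => if_neg α.toFinsupp_ne_zero]
    simp
  rw [if_neg (Ne.symm hd), zero_add]
  by_cases hr : d.degree ≤ r
  · obtain ⟨α, rfl⟩ := JetIndex.exists_toFinsupp_eq hd hr
    rw [Finset.sum_eq_single α (fun β _ h => if_neg fun h' => h (JetIndex.toFinsupp_injective h'))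
      (by simp), if_pos rfl]
  · rw [Finset.sum_eq_zero fun α _ => if_neg ?_]
    · by_contra h
      exact hr ((le_totalDegree (mem_support_iff.2 h)).trans hP)
    · rintro rfl
      exact hr (α.degree_toFinsupp.trans_le α.2.2)

variable {M : Type*} [TopologicalSpace M] [ChartedSpace (EuclideanSpace ℝ (Fin m)) M]

/-- The map to Euclidean space with given smooth components. -/
noncomputable def coordMap (X : Fin m → C^∞⟮𝓡 m, M; ℝ⟯) (q : M) : EuclideanSpace ℝ (Fin m) :=
  WithLp.toLp 2 fun i => X i q

theorem contMDiff_coordMap (X : Fin m → C^∞⟮𝓡 m, M; ℝ⟯) :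
    ContMDiff (𝓡 m) 𝓘(ℝ, EuclideanSpace ℝ (Fin m)) ∞ (coordMap X) := by
  have h : ContMDiff (𝓡 m) 𝓘(ℝ, Fin m → ℝ) ∞ fun q i => X i q :=
    contMDiff_pi_space.2 fun i => (X i).contMDiff
  exact ((PiLp.continuousLinearEquiv 2 ℝ fun _ : Fin m => ℝ).symm.contDiff.contMDiff).comp h

/-- `F` depends on the base point as well as on the running point because the Hadamard quotients do;
this is what lets the induction close. The expansion uses the uncentred `X i`, so that its monomials
do not change with the base point. -/
theorem exists_taylor (X : Fin m → C^∞⟮𝓡 m, M; ℝ⟯) (n : ℕ)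
    {F : EuclideanSpace ℝ (Fin m) × EuclideanSpace ℝ (Fin m) → ℝ} (hF : ContDiff ℝ ∞ F) :
    ∃ P : EuclideanSpace ℝ (Fin m) → MvPolynomial (Fin m) ℝ,
      (∀ y, (P y).totalDegree ≤ n) ∧ (∀ d, ContDiff ℝ ∞ fun y => (P y).coeff d) ∧
      ∀ (q : M) (g : C^∞⟮𝓡 m, M; ℝ⟯), (∀ x, g x = F (coordMap X q, coordMap X x)) →
        g - MvPolynomial.aeval X (P (coordMap X q)) ∈ pointIdeal m q ^ (n + 1) := by
  classical
  have hdiag : ContDiff ℝ ∞ fun y => F (y, y) := hF.comp (by fun_prop)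
  obtain ⟨G, hG, hFG⟩ := exists_contDiff_eq_add_sum_mul hF
  induction n generalizing F G with
  | zero =>
    refine ⟨fun y => MvPolynomial.C (F (y, y)), fun y => by simp, fun d => ?_, fun q g hg => ?_⟩
    · simp only [MvPolynomial.coeff_C]
      split_ifs
      exacts [hdiag, contDiff_const]
    · rw [MvPolynomial.aeval_C, ← hg, zero_add, pow_one]
      exact sub_const_mem_pointIdeal q g
  | succ n ih =>
    have hP : ∀ i, ∃ P : EuclideanSpace ℝ (Fin m) → MvPolynomial (Fin m) ℝ,
        (∀ y, (P y).totalDegree ≤ n) ∧ (∀ d, ContDiff ℝ ∞ fun y => (P y).coeff d) ∧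
        ∀ (q : M) (g : C^∞⟮𝓡 m, M; ℝ⟯), (∀ x, g x = G i (coordMap X q, coordMap X x)) →
          g - MvPolynomial.aeval X (P (coordMap X q)) ∈ pointIdeal m q ^ (n + 1) := by
      intro i
      obtain ⟨G', hG', hFG'⟩ := exists_contDiff_eq_add_sum_mul (hG i)
      exact ih (hG i) ((hG i).comp (by fun_prop)) G' hG' hFG'
    choose P hdeg hcoeff hmem using hP
    -- The recursion is P(y) = F(y, y) + ∑ (X_i - y_i) P_i(y), where P_i expands the i-th Hadamard
    -- quotient.
    refine ⟨fun y => MvPolynomial.C (F (y, y)) +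
      ∑ i, (MvPolynomial.X i * P i y - MvPolynomial.C (y i) * P i y), fun y => ?_, fun d => ?_,
      fun q g hg => ?_⟩
    · refine (MvPolynomial.totalDegree_add _ _).trans (max_le (by simp) ?_)
      refine MvPolynomial.totalDegree_finsetSum_le fun i _ => ?_
      refine (MvPolynomial.totalDegree_sub _ _).trans (max_le ?_ ?_)
      · refine (MvPolynomial.totalDegree_mul _ _).trans ?_
        rw [MvPolynomial.totalDegree_X, add_comm]
        exact Nat.add_le_add_right (hdeg i y) 1
      · refine (MvPolynomial.totalDegree_mul _ _).trans ?_
        rw [MvPolynomial.totalDegree_C, zero_add]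
        exact (hdeg i y).trans n.le_succ
    · simp only [MvPolynomial.coeff_add, MvPolynomial.coeff_sum, MvPolynomial.coeff_sub,
        MvPolynomial.coeff_C, MvPolynomial.coeff_C_mul, MvPolynomial.coeff_X_mul']
      refine ContDiff.add ?_ (ContDiff.sum fun i _ => ContDiff.sub ?_ ?_)
      · split_ifs
        exacts [hdiag, contDiff_const]
      · split_ifs
        exacts [hcoeff i _, contDiff_const]
      · exact (by fun_prop : ContDiff ℝ ∞ fun y : EuclideanSpace ℝ (Fin m) => y i).mul (hcoeff i d)
    · let γ : Fin m → C^∞⟮𝓡 m, M; ℝ⟯ := fun i =>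
        ⟨fun x => G i (coordMap X q, coordMap X x),
          ((hG i).comp (by fun_prop : ContDiff ℝ ∞ fun y => (coordMap X q, y))).contMDiff.comp
            (contMDiff_coordMap X)⟩
      have hsum : g - MvPolynomial.aeval X (MvPolynomial.C (F (coordMap X q, coordMap X q)) +
          ∑ i, (MvPolynomial.X i * P i (coordMap X q) -
            MvPolynomial.C (coordMap X q i) * P i (coordMap X q))) =
          ∑ i, (X i - algebraMap ℝ C^∞⟮𝓡 m, M; ℝ⟯ (X i q)) *
            (γ i - MvPolynomial.aeval X (P i (coordMap X q))) := by
        have hg' : g = algebraMap ℝ C^∞⟮𝓡 m, M; ℝ⟯ (F (coordMap X q, coordMap X q)) +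
            ∑ i, (X i - algebraMap ℝ C^∞⟮𝓡 m, M; ℝ⟯ (X i q)) * γ i := by
          ext x
          rw [hg, hFG, ContMDiffMap.coe_add, Pi.add_apply]
          congr 1
          exact (map_sum (ContMDiffMap.evalRingHom x : C^∞⟮𝓡 m, M; ℝ⟯ →+* ℝ) (fun i =>
            (X i - algebraMap ℝ C^∞⟮𝓡 m, M; ℝ⟯ (X i q)) * γ i) Finset.univ).symm
        nth_rewrite 1 [hg']
        simp only [map_add, map_sum, map_sub, map_mul, MvPolynomial.aeval_C, MvPolynomial.aeval_X,
          mul_sub, sub_mul, Finset.sum_sub_distrib]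
        simp only [coordMap]
        ring
      rw [hsum, pow_succ']
      exact Ideal.sum_mem _ fun i _ =>
        Ideal.mul_mem_mul (sub_const_mem_pointIdeal q (X i)) (hmem i q (γ i) fun _ => rfl)

variable [T2Space M] [IsManifold (𝓡 m) ∞ M]

theorem exists_coordinates {φ : OpenPartialHomeomorph M (EuclideanSpace ℝ (Fin m))}
    (hφ : φ ∈ IsManifold.maximalAtlas (𝓡 m) ∞ M) {p : M} (hp : p ∈ φ.source) :
    ∃ X : Fin m → C^∞⟮𝓡 m, M; ℝ⟯, ∀ᶠ q in 𝓝 p, ∀ i, X i q = φ q i := by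
  have h : ∀ i, ∃ f : C^∞⟮𝓡 m, M; ℝ⟯, ∀ᶠ q in 𝓝 p, f q = φ q i := fun i => by
    refine exists_contMDiffMap_eventuallyEq (g := fun q => φ q i) ?_
    filter_upwards [φ.open_source.mem_nhds hp] with q hq
    exact ((by fun_prop : ContDiff ℝ ∞ fun y : EuclideanSpace ℝ (Fin m) => y i).contMDiff
      (φ q)).comp q (contMDiffAt_of_mem_maximalAtlas hφ hq)
  choose X hX using h
  exact ⟨X, Filter.eventually_all.2 hX⟩

/-- Taylor expansion in the coordinates of a chart: the coefficients depend smoothly on the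
base point. -/
theorem exists_taylor_chart (r : ℕ) {φ : OpenPartialHomeomorph M (EuclideanSpace ℝ (Fin m))}
    (hφ : φ ∈ IsManifold.maximalAtlas (𝓡 m) ∞ M) {p : M} (hp : p ∈ φ.source)
    {X : Fin m → C^∞⟮𝓡 m, M; ℝ⟯} (hX : ∀ᶠ q in 𝓝 p, ∀ i, X i q = φ q i)
    (f : C^∞⟮𝓡 m, M; ℝ⟯) :
    ∃ a : JetIndex m r → C^∞⟮𝓡 m, M; ℝ⟯, ∀ᶠ q in 𝓝 p,
      coJetLinear m r q f =
        ∑ α, a α q • coJetLinear m r q (∏ i, X i ^ (α.1 i : ℕ)) := by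
  -- Hadamard's lemma needs a function on all of Euclidean space, so f in the chart is replaced by a
  -- global function with the same germ at `φ p`.
  obtain ⟨F, hF⟩ := exists_contMDiffMap_eventuallyEq (m := m) (p := φ p)
    (g := fun y => f (φ.symm y)) (by
      filter_upwards [φ.open_target.mem_nhds (φ.map_source hp)] with y hy
      exact f.contMDiff.contMDiffAt.comp y (contMDiffAt_symm_of_mem_maximalAtlas hφ hy))
  have hFs : ContDiff ℝ ∞ F := F.contMDiff.contDiff
  obtain ⟨P, hdeg, hcoeff, hmem⟩ := exists_taylor X r
    (F := fun z => F z.2) (hFs.comp contDiff_snd)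
  let g : C^∞⟮𝓡 m, M; ℝ⟯ := ⟨fun q => F (coordMap X q), F.contMDiff.comp (contMDiff_coordMap X)⟩
  have hfg : ∀ᶠ q in 𝓝 p, f q = g q := by
    filter_upwards [hX, (φ.continuousAt hp).eventually hF, φ.open_source.mem_nhds hp] with q h1 h2 h3
    have : coordMap X q = φ q := by
      ext i
      exact h1 i
    change f q = F (coordMap X q)
    rw [this, h2, φ.left_inv h3]
  refine ⟨fun α => ⟨fun q => (P (coordMap X q)).coeff α.toFinsupp,
    (hcoeff α.toFinsupp).contMDiff.comp (contMDiff_coordMap X)⟩, ?_⟩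
  filter_upwards [hfg.eventually_nhds] with q hq
  rw [coJetLinear_congr hq, ← sub_eq_zero]
  simp only [← map_smul, ← map_sum]
  rw [← map_sub]
  -- Constants have zero class, so the constant term of the Taylor polynomial drops out.
  refine coJetLinear_eq_zero ((P (coordMap X q)).coeff 0) ?_
  have h := hmem q g fun _ => rfl
  rw [MvPolynomial.eq_C_add_sum_jetIndex (hdeg (coordMap X q))] at h
  simp only [map_add, map_sum, MvPolynomial.aeval_C, MvPolynomial.aeval_monomial,
    JetIndex.prod_toFinsupp, ← Algebra.smul_def] at h
  rw [sub_right_comm, sub_sub]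
  exact h

end Taylor

/-! ### Linear independence of the monomials -/

section Independence

open Asymptotics

/-- Otherwise Q = t^k R with R(0) ≠ 0 and k ≤ r; dividing by t^k gives R(t) = O(t^(r+1-k)), which
forces R(0) = 0. -/
theorem Polynomial.eq_zero_of_isBigO {Q : Polynomial ℝ} {r : ℕ} (hQ : Q.natDegree ≤ r)
    (h : (fun t => Q.eval t) =O[𝓝 0] fun t : ℝ => t ^ (r + 1)) : Q = 0 := by
  by_contra h0
  obtain ⟨R, hR, hR0⟩ := Polynomial.exists_eq_pow_rootMultiplicity_mul_and_not_dvd Q h0 0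
  have hk : Q.rootMultiplicity 0 ≤ r := by
    refine le_trans ?_ hQ
    rw [← Polynomial.count_roots]
    exact (Multiset.count_le_card _ _).trans Q.card_roots'
  set k := Q.rootMultiplicity 0
  rw [Polynomial.dvd_iff_isRoot, Polynomial.IsRoot.def] at hR0
  have h1 : (fun t : ℝ => t ^ k * R.eval t) =O[𝓝[≠] 0] fun t : ℝ => t ^ k * t ^ (r + 1 - k) := by
    refine (h.mono nhdsWithin_le_nhds).congr (fun t => ?_) fun t => ?_
    · conv_lhs => rw [hR]
      simp
    · rw [← pow_add]
      congr 1
      omega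
  have h2 : (fun t : ℝ => R.eval t) =O[𝓝[≠] 0] fun t : ℝ => t ^ (r + 1 - k) := by
    obtain ⟨C, hC⟩ := h1.bound
    refine IsBigO.of_bound C ?_
    filter_upwards [hC, self_mem_nhdsWithin] with t ht ht0
    have : 0 < ‖t ^ k‖ := norm_pos_iff.2 (pow_ne_zero _ ht0)
    rw [norm_mul, norm_mul, mul_left_comm] at ht
    exact le_of_mul_le_mul_left ht this
  have h3 : Filter.Tendsto (fun t : ℝ => t ^ (r + 1 - k)) (𝓝[≠] 0) (𝓝 0) := by
    have : ContinuousAt (fun t : ℝ => t ^ (r + 1 - k)) 0 := by fun_prop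
    have := this.tendsto.mono_left (nhdsWithin_le_nhds (s := {0}ᶜ))
    rwa [zero_pow (by omega)] at this
  have h4 := h2.trans_tendsto h3
  have h5 : Filter.Tendsto (fun t : ℝ => R.eval t) (𝓝[≠] 0) (𝓝 (R.eval 0)) :=
    R.continuous.continuousAt.tendsto.mono_left nhdsWithin_le_nhds
  exact hR0 (tendsto_nhds_unique h5 h4)

variable {m : ℕ} {M : Type*} [TopologicalSpace M] [ChartedSpace (EuclideanSpace ℝ (Fin m)) M]

/-- Each factor that vanishes at p is O(t) along a line in the chart, by differentiability. -/
theorem isBigO_of_mem_pointIdeal_pow {φ : OpenPartialHomeomorph M (EuclideanSpace ℝ (Fin m))}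
    (hφ : φ ∈ IsManifold.maximalAtlas (𝓡 m) ∞ M) {p : M} (hp : p ∈ φ.source)
    (v : EuclideanSpace ℝ (Fin m)) {n : ℕ} {f : C^∞⟮𝓡 m, M; ℝ⟯} (hf : f ∈ pointIdeal m p ^ n) :
    (fun t : ℝ => f (φ.symm (φ p + t • v))) =O[𝓝 0] fun t : ℝ => t ^ n := by
  induction n generalizing f with
  | zero =>
    have hc : ContinuousAt (fun t : ℝ => f (φ.symm (φ p + t • v))) 0 := by
      refine ContinuousAt.comp (f := fun t : ℝ => φ.symm (φ p + t • v))
        f.contMDiff.continuous.continuousAt (ContinuousAt.comp (g := φ.symm)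
          (f := fun t : ℝ => φ p + t • v) ?_ (by fun_prop))
      simpa using φ.continuousAt_symm (φ.map_source hp)
    simpa using hc.tendsto.isBigO_one ℝ
  | succ n ih =>
    rw [pow_succ'] at hf
    refine Submodule.mul_induction_on hf (fun a ha b hb => ?_) fun a b ha hb => ?_
    · simp only [pow_succ']
      refine IsBigO.mul ?_ (ih hb)
      have hd : DifferentiableAt ℝ (fun y => a (φ.symm y)) (φ p) := by
        have := a.contMDiff.contMDiffAt.comp (φ p)
          (contMDiffAt_symm_of_mem_maximalAtlas hφ (φ.map_source hp))
        exact this.contDiffAt.differentiableAt (by simp)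
      have hd' : DifferentiableAt ℝ (fun t : ℝ => a (φ.symm (φ p + t • v))) 0 :=
        DifferentiableAt.comp (g := fun y => a (φ.symm y)) (f := fun t : ℝ => φ p + t • v) 0
          (by simpa using hd) (by fun_prop)
      have := hd'.isBigO_sub
      simpa [φ.left_inv hp, mem_pointIdeal.1 ha] using this
    · exact IsBigO.add ha hb

/-- On the line from `φ p` to an arbitrary y, reached at t = 1, P becomes a polynomial in t of
degree ≤ r that is O(t^(r+1)). It vanishes identically, so P(y) = 0 even when y lies outside the
image of the chart. -/
theorem MvPolynomial.eq_zero_of_mem_pointIdeal_pow {r : ℕ}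
    {φ : OpenPartialHomeomorph M (EuclideanSpace ℝ (Fin m))}
    (hφ : φ ∈ IsManifold.maximalAtlas (𝓡 m) ∞ M) {p : M} (hp : p ∈ φ.source)
    {P : MvPolynomial (Fin m) ℝ} (hP : P.totalDegree ≤ r) {f : C^∞⟮𝓡 m, M; ℝ⟯}
    (hf : f ∈ pointIdeal m p ^ (r + 1)) (hfP : ∀ᶠ q in 𝓝 p, f q = eval (fun i => φ q i) P) :
    P = 0 := by
  refine MvPolynomial.funext fun y => ?_
  rw [map_zero]
  let v : EuclideanSpace ℝ (Fin m) := WithLp.toLp 2 y - φ p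
  let Q : Polynomial ℝ := aeval (fun i => Polynomial.C (φ p i) +
    Polynomial.C (v i) * Polynomial.X) P
  have hev : ∀ t, Q.eval t = eval (fun i => φ p i + t * v i) P := by
    intro t
    have h : (Polynomial.aeval t).comp (aeval fun i => Polynomial.C (φ p i) +
        Polynomial.C (v i) * Polynomial.X) = aeval (R := ℝ) fun i => φ p i + t * v i := by
      refine MvPolynomial.algHom_ext fun i => ?_
      rw [AlgHom.comp_apply, aeval_X, aeval_X, map_add, map_mul, Polynomial.aeval_X,
        Polynomial.aeval_C, Polynomial.aeval_C, mul_comm]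
      rfl
    exact DFunLike.congr_fun h P
  have hQ : Q = 0 := by
    refine Polynomial.eq_zero_of_isBigO (r := r) ?_ ?_
    · simpa using MvPolynomial.aeval_natDegree_le P hP _ (n := 1) fun i => by compute_degree
    · refine (isBigO_of_mem_pointIdeal_pow hφ hp v hf).congr' ?_ Filter.EventuallyEq.rfl
      have hline : Filter.Tendsto (fun t : ℝ => φ p + t • v) (𝓝 0) (𝓝 (φ p)) := by
        have : ContinuousAt (fun t : ℝ => φ p + t • v) 0 := by fun_prop
        simpa using this.tendsto
      have hc : Filter.Tendsto φ.symm (𝓝 (φ p)) (𝓝 p) := by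
        simpa [φ.left_inv hp] using (φ.continuousAt_symm (φ.map_source hp)).tendsto
      filter_upwards [(hc.comp hline).eventually hfP,
        hline.eventually (φ.open_target.mem_nhds (φ.map_source hp))] with t h1 h2
      rw [Function.comp_apply, φ.right_inv h2] at h1
      rw [h1, hev]
      simp
  have := hev 1
  rw [hQ] at this
  simpa [v] using this.symm

end Independence

/-! ### Jet coordinates in a chart -/

section Coordinates

variable {m : ℕ} {M : Type*} [TopologicalSpace M] [ChartedSpace (EuclideanSpace ℝ (Fin m)) M]
  {φ : OpenPartialHomeomorph M (EuclideanSpace ℝ (Fin m))}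

theorem eventually_prod_pow_eq {X : Fin m → C^∞⟮𝓡 m, M; ℝ⟯} {p : M}
    (hX : ∀ᶠ q in 𝓝 p, ∀ i, X i q = φ q i) {r : ℕ} (α : JetIndex m r) :
    ∀ᶠ q in 𝓝 p, (∏ i, X i ^ (α.1 i : ℕ)) q = ∏ i, φ q i ^ (α.1 i : ℕ) := by
  filter_upwards [hX] with q hq
  simp only [← hq]
  refine (map_prod (ContMDiffMap.evalRingHom q : C^∞⟮𝓡 m, M; ℝ⟯ →+* ℝ)
    (fun i => X i ^ (α.1 i : ℕ)) Finset.univ).trans (Finset.prod_congr rfl fun i _ => ?_)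
  exact map_pow (ContMDiffMap.evalRingHom q : C^∞⟮𝓡 m, M; ℝ⟯ →+* ℝ) (X i) _

variable [T2Space M] [IsManifold (𝓡 m) ∞ M]

theorem linearIndependent_coJetLinear (r : ℕ) (hφ : φ ∈ IsManifold.maximalAtlas (𝓡 m) ∞ M)
    {p : M} (hp : p ∈ φ.source) {X : Fin m → C^∞⟮𝓡 m, M; ℝ⟯}
    (hX : ∀ᶠ q in 𝓝 p, ∀ i, X i q = φ q i) :
    LinearIndependent ℝ fun α : JetIndex m r =>
      coJetLinear m r p (∏ i, X i ^ (α.1 i : ℕ)) := by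
  classical
  rw [Fintype.linearIndependent_iff]
  intro c hc α
  simp only [← map_smul, ← map_sum] at hc
  rw [coJetLinear_eq_zero_iff] at hc
  -- The monomials are not centred at p, so their combination may have a nonzero value `k` there.
  -- Subtracting it affects only the constant coefficient, and no `JetIndex` has exponent zero.
  set k := (∑ α : JetIndex m r, c α • ∏ i, X i ^ (α.1 i : ℕ)) p
  let P : MvPolynomial (Fin m) ℝ :=
    ∑ α : JetIndex m r, MvPolynomial.monomial α.toFinsupp (c α) - MvPolynomial.C k
  have hP : P.totalDegree ≤ r := by
    refine (MvPolynomial.totalDegree_sub _ _).trans (max_le ?_ (by simp))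
    refine MvPolynomial.totalDegree_finsetSum_le fun β _ => ?_
    refine (MvPolynomial.totalDegree_monomial_le _ _).trans ?_
    exact β.degree_toFinsupp.trans_le β.2.2
  have hP0 : P = 0 := by
    refine MvPolynomial.eq_zero_of_mem_pointIdeal_pow hφ hp hP hc ?_
    filter_upwards [Filter.eventually_all.2 fun β : JetIndex m r => eventually_prod_pow_eq hX β]
      with q hq
    simp only [P, map_sub, map_sum, MvPolynomial.eval_monomial, MvPolynomial.eval_C,
      JetIndex.prod_toFinsupp, ← hq]
    refine congrArg (· - k) ?_
    exact map_sum (ContMDiffMap.evalRingHom q : C^∞⟮𝓡 m, M; ℝ⟯ →+* ℝ)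
      (fun α : JetIndex m r => c α • ∏ i, X i ^ (α.1 i : ℕ)) Finset.univ
  have h := congrArg (MvPolynomial.coeff α.toFinsupp) hP0
  simpa [P, MvPolynomial.coeff_sum, MvPolynomial.coeff_monomial, JetIndex.toFinsupp_injective.eq_iff,
    MvPolynomial.coeff_C, α.toFinsupp_ne_zero.symm] using h

theorem top_le_span_coJetLinear (r : ℕ) (hφ : φ ∈ IsManifold.maximalAtlas (𝓡 m) ∞ M)
    {p : M} (hp : p ∈ φ.source) {X : Fin m → C^∞⟮𝓡 m, M; ℝ⟯}
    (hX : ∀ᶠ q in 𝓝 p, ∀ i, X i q = φ q i) :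
    ⊤ ≤ Submodule.span ℝ (Set.range fun α : JetIndex m r =>
      coJetLinear m r p (∏ i, X i ^ (α.1 i : ℕ))) := by
  rintro x -
  obtain ⟨f, rfl⟩ := coJetLinear_surjective r p x
  obtain ⟨a, ha⟩ := exists_taylor_chart r hφ hp hX f
  rw [ha.self_of_nhds]
  exact Submodule.sum_mem _ fun α _ =>
    Submodule.smul_mem _ _ (Submodule.subset_span (Set.mem_range_self α))

/-- The basis of `I_p / I_p ^ (r + 1)` given by the monomials in the coordinates of a chart. -/
noncomputable def coJetBasis (r : ℕ) (hφ : φ ∈ IsManifold.maximalAtlas (𝓡 m) ∞ M) {p : M}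
    (hp : p ∈ φ.source) : Module.Basis (JetIndex m r) ℝ (CoJet m r p) :=
  Module.Basis.mk (linearIndependent_coJetLinear r hφ hp (exists_coordinates hφ hp).choose_spec)
    (top_le_span_coJetLinear r hφ hp (exists_coordinates hφ hp).choose_spec)

/-- The coordinates of a jet: its values at the monomials in the coordinates of a chart. -/
noncomputable def jetCoord (r : ℕ) (hφ : φ ∈ IsManifold.maximalAtlas (𝓡 m) ∞ M) {p : M}
    (hp : p ∈ φ.source) : JetFiber m r p ≃ₗ[ℝ] JetModel m r :=
  ((coJetBasis r hφ hp).constr ℝ).symm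

theorem jetCoord_apply {r : ℕ} (hφ : φ ∈ IsManifold.maximalAtlas (𝓡 m) ∞ M) {p : M}
    (hp : p ∈ φ.source) (ξ : JetFiber m r p) (α : JetIndex m r) {f : C^∞⟮𝓡 m, M; ℝ⟯}
    (hf : ∀ᶠ q in 𝓝 p, f q = ∏ i, φ q i ^ (α.1 i : ℕ)) : jetCoord r hφ hp ξ α = ξ.act f := by
  have h : jetCoord r hφ hp ξ α =
      ξ.act (∏ i, (exists_coordinates hφ hp).choose i ^ (α.1 i : ℕ)) := by
    change (show Module.Dual ℝ (CoJet m r p) from ξ) (coJetBasis r hφ hp α) = _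
    rw [coJetBasis, Module.Basis.mk_apply]
    rfl
  rw [h]
  refine ξ.act_congr ?_
  filter_upwards [hf, eventually_prod_pow_eq (exists_coordinates hφ hp).choose_spec α]
    with q h1 h2
  rw [h1, h2]

/-- One global function represents x^α at all points near p; this makes a jet coordinate the value
of the jet at a fixed function. -/
theorem exists_eventually_jetCoord_eq (r : ℕ) (hφ : φ ∈ IsManifold.maximalAtlas (𝓡 m) ∞ M)
    {p : M} (hp : p ∈ φ.source) (α : JetIndex m r) :
    ∃ f : C^∞⟮𝓡 m, M; ℝ⟯, ∀ᶠ q in 𝓝 p, ∀ (hq : q ∈ φ.source) (ξ : JetFiber m r q),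
      jetCoord r hφ hq ξ α = ξ.act f := by
  obtain ⟨X, hX⟩ := exists_coordinates hφ hp
  refine ⟨∏ i, X i ^ (α.1 i : ℕ), ?_⟩
  filter_upwards [(eventually_prod_pow_eq hX α).eventually_nhds] with q h hq ξ
  exact jetCoord_apply hφ hq ξ α h

theorem exists_eventually_act_eq_sum (r : ℕ) (hφ : φ ∈ IsManifold.maximalAtlas (𝓡 m) ∞ M)
    {p : M} (hp : p ∈ φ.source) (f : C^∞⟮𝓡 m, M; ℝ⟯) :
    ∃ a : JetIndex m r → C^∞⟮𝓡 m, M; ℝ⟯, ∀ᶠ q in 𝓝 p, ∀ (hq : q ∈ φ.source)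
      (ξ : JetFiber m r q), ξ.act f = ∑ α, a α q * jetCoord r hφ hq ξ α := by
  obtain ⟨X, hX⟩ := exists_coordinates hφ hp
  obtain ⟨a, ha⟩ := exists_taylor_chart r hφ hp hX f
  refine ⟨a, ?_⟩
  filter_upwards [ha, hX.eventually_nhds] with q h hXq hq ξ
  simp only [jetCoord_apply hφ hq ξ _ (eventually_prod_pow_eq hXq _)]
  let L : Module.Dual ℝ (CoJet m r q) := ξ
  have h' : L _ = L _ := congrArg L h
  rw [map_sum] at h'
  simp only [map_smul] at h'
  exact h'

open Classical in
/-- The change of jet coordinates between two charts. -/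
noncomputable def jetCoordChange (r : ℕ) {ψ : OpenPartialHomeomorph M (EuclideanSpace ℝ (Fin m))}
    (hφ : φ ∈ IsManifold.maximalAtlas (𝓡 m) ∞ M) (hψ : ψ ∈ IsManifold.maximalAtlas (𝓡 m) ∞ M)
    (q : M) : JetModel m r →L[ℝ] JetModel m r :=
  if h : q ∈ φ.source ∩ ψ.source then
    LinearMap.toContinuousLinearMap
      ((jetCoord r hφ h.1).symm.trans (jetCoord r hψ h.2)).toLinearMap
  else 0

/-- The β-th coordinate in `ψ` is ξ(y^β). Taylor expansion of y^β in the monomials of `φ` gives the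
matrix entries, which are smooth in the base point. -/
theorem contMDiffOn_jetCoordChange (r : ℕ)
    {ψ : OpenPartialHomeomorph M (EuclideanSpace ℝ (Fin m))}
    (hφ : φ ∈ IsManifold.maximalAtlas (𝓡 m) ∞ M) (hψ : ψ ∈ IsManifold.maximalAtlas (𝓡 m) ∞ M) :
    ContMDiffOn (𝓡 m) 𝓘(ℝ, JetModel m r →L[ℝ] JetModel m r) ∞ (jetCoordChange r hφ hψ)
      (φ.source ∩ ψ.source) := by
  classical
  intro p hp
  choose f hf using exists_eventually_jetCoord_eq r hψ hp.2
  choose a ha using fun β => exists_eventually_act_eq_sum r hφ hp.1 (f β)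
  have hs : ContMDiffAt (𝓡 m) 𝓘(ℝ, JetModel m r →L[ℝ] JetModel m r) ∞ (fun q =>
      ∑ β : JetIndex m r, ∑ α : JetIndex m r, a β α q •
        (ContinuousLinearMap.proj (R := ℝ) (φ := fun _ : JetIndex m r => ℝ) α).smulRight
          (Pi.single β 1 : JetModel m r)) p :=
    ContMDiffAt.sum fun β _ => ContMDiffAt.sum fun α _ =>
      (a β α).contMDiff.contMDiffAt.smul contMDiffAt_const
  refine (hs.congr_of_eventuallyEq ?_).contMDiffWithinAt
  filter_upwards [Filter.eventually_all.2 hf, Filter.eventually_all.2 ha,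
    (φ.open_source.inter ψ.open_source).mem_nhds hp] with q h1 h2 hq
  ext v β
  rw [jetCoordChange, dif_pos hq]
  change jetCoord r hψ hq.2 ((jetCoord r hφ hq.1).symm v) β = _
  rw [h1 β hq.2, h2 β hq.1]
  simp [Finset.sum_apply, Pi.single_apply]

end Coordinates

/-! ### The jet bundle -/

section Bundle

open Bundle

variable {m : ℕ} {M : Type*} [TopologicalSpace M] [T2Space M]
  [ChartedSpace (EuclideanSpace ℝ (Fin m)) M] [IsManifold (𝓡 m) ∞ M]

open Classical in
/-- The pretrivialization of the jet bundle given by a chart. -/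
noncomputable def jetPretrivialization (r : ℕ)
    {φ : OpenPartialHomeomorph M (EuclideanSpace ℝ (Fin m))}
    (hφ : φ ∈ IsManifold.maximalAtlas (𝓡 m) ∞ M) :
    Pretrivialization (JetModel m r)
      (TotalSpace.proj : TotalSpace (JetModel m r) (fun p : M => JetFiber m r p) → M) where
  toFun z := (z.1, if h : z.1 ∈ φ.source then jetCoord r hφ h z.2 else 0)
  invFun y := ⟨y.1, if h : y.1 ∈ φ.source then (jetCoord r hφ h).symm y.2 else 0⟩
  source := TotalSpace.proj ⁻¹' φ.source
  target := φ.source ×ˢ Set.univ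
  map_source' _ hz := ⟨hz, trivial⟩
  map_target' _ hy := hy.1
  left_inv' z hz := by
    have hz' : z.1 ∈ φ.source := hz
    simp [hz']
  right_inv' y hy := by
    have hy' : y.1 ∈ φ.source := hy.1
    simp [hy']
  open_target := φ.open_source.prod isOpen_univ
  baseSet := φ.source
  open_baseSet := φ.open_source
  source_eq := rfl
  target_eq := rfl
  proj_toFun _ _ := rfl

variable {r : ℕ} {φ : OpenPartialHomeomorph M (EuclideanSpace ℝ (Fin m))}
  (hφ : φ ∈ IsManifold.maximalAtlas (𝓡 m) ∞ M)

theorem jetPretrivialization_apply {p : M} (hp : p ∈ φ.source) (ξ : JetFiber m r p) :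
    (jetPretrivialization r hφ ⟨p, ξ⟩).2 = jetCoord r hφ hp ξ :=
  dif_pos hp

theorem jetPretrivialization_symm {p : M} (hp : p ∈ φ.source) (v : JetModel m r) :
    (jetPretrivialization r hφ).symm p v = (jetCoord r hφ hp).symm v := by
  rw [LinearEquiv.eq_symm_apply, ← jetPretrivialization_apply hφ hp,
    Pretrivialization.apply_mk_symm _ (show p ∈ (jetPretrivialization r hφ).baseSet from hp)]

variable (m M r) in
/-- The topology of a fibre of the jet bundle, transported from the model fibre. -/
@[reducible]
noncomputable def jetFiberTopology (p : M) : TopologicalSpace (JetFiber m r p) :=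
  TopologicalSpace.induced
    (jetCoord r (IsManifold.chart_mem_maximalAtlas (I := 𝓡 m) (n := ∞) p)
      (mem_chart_source (EuclideanSpace ℝ (Fin m)) p)) inferInstance

attribute [local instance] jetFiberTopology

theorem jetCoordChange_apply {ψ : OpenPartialHomeomorph M (EuclideanSpace ℝ (Fin m))}
    (hψ : ψ ∈ IsManifold.maximalAtlas (𝓡 m) ∞ M) {p : M} (hp : p ∈ φ.source ∩ ψ.source)
    (v : JetModel m r) : jetCoordChange r hφ hψ p v =
      (jetPretrivialization r hψ ⟨p, (jetPretrivialization r hφ).symm p v⟩).2 := by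
  rw [jetCoordChange, dif_pos hp, jetPretrivialization_apply hψ hp.2,
    jetPretrivialization_symm hφ hp.1]
  rfl

variable (m M r) in
/-- The prebundle of jets, with a pretrivialization for every chart of the manifold. -/
noncomputable def jetPrebundle :
    VectorPrebundle ℝ (JetModel m r) (fun p : M => JetFiber m r p) where
  -- Admitting all charts of the maximal atlas, not only the preferred ones, makes every chart give
  -- a trivialization in the bundle atlas.
  pretrivializationAtlas := {e | ∃ (φ : OpenPartialHomeomorph M (EuclideanSpace ℝ (Fin m)))
    (hφ : φ ∈ IsManifold.maximalAtlas (𝓡 m) ∞ M), e = jetPretrivialization r hφ}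
  pretrivialization_linear' := by
    rintro _ ⟨φ, hφ, rfl⟩
    refine ⟨fun p hp => ?_⟩
    simp only [jetPretrivialization_apply hφ (p := p) hp]
    exact (jetCoord r hφ hp).toLinearMap.isLinear
  pretrivializationAt p :=
    jetPretrivialization r (IsManifold.chart_mem_maximalAtlas (I := 𝓡 m) (n := ∞) p)
  mem_base_pretrivializationAt p := mem_chart_source (EuclideanSpace ℝ (Fin m)) p
  pretrivialization_mem_atlas p := ⟨_, _, rfl⟩
  exists_coordChange := by
    rintro _ ⟨φ, hφ, rfl⟩ _ ⟨ψ, hψ, rfl⟩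
    exact ⟨jetCoordChange r hφ hψ, (contMDiffOn_jetCoordChange r hφ hψ).continuousOn,
      fun p hp v => jetCoordChange_apply hφ hψ hp v⟩
  totalSpaceMk_isInducing p := by
    have h : Topology.IsInducing (jetCoord r
        (IsManifold.chart_mem_maximalAtlas (I := 𝓡 m) (n := ∞) p)
        (mem_chart_source (EuclideanSpace ℝ (Fin m)) p)) := ⟨rfl⟩
    convert Topology.isInducing_const_prod.2 h using 1
    · funext ξ
      exact Prod.ext rfl (jetPretrivialization_apply _ (mem_chart_source _ p) ξ)

instance isContMDiff_jetPrebundle : (jetPrebundle m M r).IsContMDiff (𝓡 m) ∞ where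
  exists_contMDiffCoordChange := by
    rintro _ ⟨φ, hφ, rfl⟩ _ ⟨ψ, hψ, rfl⟩
    exact ⟨jetCoordChange r hφ hψ, contMDiffOn_jetCoordChange r hφ hψ,
      fun p hp v => jetCoordChange_apply hφ hψ hp v⟩

variable (m M r) in
/-- The topology of the total space of the jet bundle. -/
@[reducible]
noncomputable def jetTotalSpaceTopology :
    TopologicalSpace (TotalSpace (JetModel m r) fun p : M => JetFiber m r p) :=
  (jetPrebundle m M r).totalSpaceTopology

attribute [local instance] jetTotalSpaceTopology

variable (m M r) in
/-- The fibre bundle of jets. -/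
@[reducible]
noncomputable def jetFiberBundle : FiberBundle (JetModel m r) fun p : M => JetFiber m r p :=
  (jetPrebundle m M r).toFiberBundle

attribute [local instance] jetFiberBundle

theorem jetVectorBundle : VectorBundle ℝ (JetModel m r) fun p : M => JetFiber m r p :=
  (jetPrebundle m M r).toVectorBundle

attribute [local instance] jetVectorBundle

theorem jetContMDiffVectorBundle :
    ContMDiffVectorBundle ∞ (JetModel m r) (fun p : M => JetFiber m r p) (𝓡 m) :=
  (jetPrebundle m M r).contMDiffVectorBundle (𝓡 m)

theorem exists_trivialization_of_mem_maximalAtlas (r : ℕ)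
    {φ : OpenPartialHomeomorph M (EuclideanSpace ℝ (Fin m))}
    (hφ : φ ∈ IsManifold.maximalAtlas (𝓡 m) ∞ M) :
    ∃ e : Trivialization (JetModel m r)
        (TotalSpace.proj : TotalSpace (JetModel m r) (fun p : M => JetFiber m r p) → M),
      MemTrivializationAtlas e ∧ e.baseSet = φ.source ∧
      ∀ p ∈ φ.source, ∀ (ξ : JetFiber m r p) (α : JetIndex m r) (f : C^∞⟮𝓡 m, M; ℝ⟯),
        (∀ᶠ q in 𝓝 p, f q = ∏ i, (φ q i) ^ (α.1 i : ℕ)) → (e ⟨p, ξ⟩).2 α = ξ.act f := by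
  have he : jetPretrivialization r hφ ∈ (jetPrebundle m M r).pretrivializationAtlas :=
    ⟨φ, hφ, rfl⟩
  refine ⟨(jetPrebundle m M r).trivializationOfMemPretrivializationAtlas he, ⟨_, he, rfl⟩, rfl,
    fun p hp ξ α f hf => ?_⟩
  rw [← jetCoord_apply hφ hp ξ α hf, ← jetPretrivialization_apply hφ hp]
  rfl

/-- A section of the jet bundle is smooth if and only if its values at all smooth functions are. -/
theorem contMDiff_jetSection_iff {s : ∀ p : M, JetFiber m r p} :
    ContMDiff (𝓡 m) ((𝓡 m).prod 𝓘(ℝ, JetModel m r)) ∞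
        (fun p => TotalSpace.mk' (JetModel m r) p (s p)) ↔
      ∀ f : C^∞⟮𝓡 m, M; ℝ⟯, ContMDiff (𝓡 m) 𝓘(ℝ, ℝ) ∞ fun p => (s p).act f := by
  have htriv : ∀ p, ∀ q (hq : q ∈ (chartAt (EuclideanSpace ℝ (Fin m)) p).source),
      (trivializationAt (JetModel m r) (fun p : M => JetFiber m r p) p ⟨q, s q⟩).2 =
        jetCoord r (IsManifold.chart_mem_maximalAtlas (I := 𝓡 m) (n := ∞) p) hq (s q) :=
    fun p q hq => jetPretrivialization_apply _ hq _
  constructor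
  · intro hs f p
    obtain ⟨a, ha⟩ := exists_eventually_act_eq_sum r
      (IsManifold.chart_mem_maximalAtlas (I := 𝓡 m) (n := ∞) p) (mem_chart_source _ p) f
    have h := contMDiffAt_pi_space.1 ((Bundle.contMDiffAt_section p).1 (hs p))
    have hsum : ContMDiffAt (𝓡 m) 𝓘(ℝ, ℝ) ∞ (fun q => ∑ α, a α q *
        (trivializationAt (JetModel m r) (fun p : M => JetFiber m r p) p ⟨q, s q⟩).2 α) p :=
      ContMDiffAt.sum fun α _ => (a α).contMDiff.contMDiffAt.mul (h α)
    refine hsum.congr_of_eventuallyEq ?_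
    filter_upwards [ha, (chartAt (EuclideanSpace ℝ (Fin m)) p).open_source.mem_nhds
      (mem_chart_source _ p)] with q h1 hq
    rw [h1 hq, htriv p q hq]
  · intro hs p
    rw [Bundle.contMDiffAt_section, contMDiffAt_pi_space]
    intro α
    obtain ⟨f, hf⟩ := exists_eventually_jetCoord_eq r
      (IsManifold.chart_mem_maximalAtlas (I := 𝓡 m) (n := ∞) p) (mem_chart_source _ p) α
    refine (hs f p).congr_of_eventuallyEq ?_
    filter_upwards [hf, (chartAt (EuclideanSpace ℝ (Fin m)) p).open_source.mem_nhds
      (mem_chart_source _ p)] with q h1 hq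
    rw [htriv p q hq, h1 hq]

variable (m M r) in
/-- The derivation of order `≤ r` given by a smooth section of the jet bundle. -/
noncomputable def jetSectionToDerivation :
    ContMDiffSection (𝓡 m) (JetModel m r) ∞ (fun p : M => JetFiber m r p) →ₗ[ℝ]
      higherDerivations ℝ C^∞⟮𝓡 m, M; ℝ⟯ r where
  toFun s :=
    ⟨{ toFun := fun f => ⟨fun p => (s p).act f, contMDiff_jetSection_iff.1 s.contMDiff f⟩
       map_add' := fun f g => ContMDiffMap.ext fun p => map_add (s p).toDual f g
       map_smul' := fun c f => ContMDiffMap.ext fun p => map_smul (s p).toDual c f },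
      isDiffOp_of_forall_mem_pow fun p _ hf => (s p).act_eq_zero hf,
      fun c => ContMDiffMap.ext fun p => (s p).act_algebraMap c⟩
  map_add' s t := Subtype.ext <| LinearMap.ext fun f => ContMDiffMap.ext fun p =>
    (s p).add_act (t p) f
  map_smul' c s := Subtype.ext <| LinearMap.ext fun f => ContMDiffMap.ext fun p =>
    (s p).smul_act c f

theorem jetSectionToDerivation_apply
    (s : ContMDiffSection (𝓡 m) (JetModel m r) ∞ (fun p : M => JetFiber m r p))
    (f : C^∞⟮𝓡 m, M; ℝ⟯) (p : M) :
    (jetSectionToDerivation m M r s : C^∞⟮𝓡 m, M; ℝ⟯ →ₗ[ℝ] C^∞⟮𝓡 m, M; ℝ⟯) f p = (s p).act f :=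
  rfl

/-- A jet is determined by its values on functions, whence injectivity. Conversely f ↦ Df(p) kills
constants and 𝔪_p^(r+1), so it is a jet; the resulting section is smooth because each Df is. -/
theorem jetSectionToDerivation_bijective :
    Function.Bijective (jetSectionToDerivation m M r) := by
  constructor
  · intro s t hst
    refine ContMDiffSection.ext fun p => JetFiber.ext_act fun f => ?_
    rw [← jetSectionToDerivation_apply, hst, jetSectionToDerivation_apply]
  · rintro ⟨D, hD, hc⟩
    have h : ∀ p : M, ∃ ξ : JetFiber m r p, ∀ f, ξ.act f = D f p := fun p =>
      exists_jetFiber_act_eq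
        { toFun := fun f => D f p
          map_add' := fun f g => by rw [map_add]; rfl
          map_smul' := fun c f => by rw [map_smul]; rfl }
        (fun c => by
          change D (algebraMap ℝ C^∞⟮𝓡 m, M; ℝ⟯ c) p = 0
          rw [hc]
          rfl)
        fun _ hf => hD.apply_eq_zero p hf
    choose s hs using h
    refine ⟨⟨s, contMDiff_jetSection_iff.2 fun f => ?_⟩, ?_⟩
    · simp only [hs]
      exact (D f).contMDiff
    · exact Subtype.ext <| LinearMap.ext fun f => ContMDiffMap.ext fun p => hs p f

variable (m M r) in
/-- Smooth sections of the jet bundle are the same as derivations of order `≤ r`. -/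
noncomputable def jetSectionEquiv :
    ContMDiffSection (𝓡 m) (JetModel m r) ∞ (fun p : M => JetFiber m r p) ≃ₗ[ℝ]
      higherDerivations ℝ C^∞⟮𝓡 m, M; ℝ⟯ r :=
  LinearEquiv.ofBijective (jetSectionToDerivation m M r) jetSectionToDerivation_bijective

end Bundle

theorem mainTheorem3 (m r : ℕ) (M : Type*) [TopologicalSpace M] [T2Space M]
    [ChartedSpace (EuclideanSpace ℝ (Fin m)) M] [IsManifold (𝓡 m) ∞ M] :
    -- a smooth vector bundle over `M` with fibres `J_p^r`
    ∃ (_ : TopologicalSpace (Bundle.TotalSpace (JetModel m r) fun p : M => JetFiber m r p))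
      (_ : ∀ p : M, TopologicalSpace (JetFiber m r p))
      (_ : FiberBundle (JetModel m r) fun p : M => JetFiber m r p)
      (_ : VectorBundle ℝ (JetModel m r) fun p : M => JetFiber m r p)
      (_ : ContMDiffVectorBundle ∞ (JetModel m r) (fun p : M => JetFiber m r p) (𝓡 m)),
      -- every chart `φ = (x^1, …, x^m)` of `M` gives the trivialization whose fibre coordinates
      -- are the values `ξ(x^α)`, `1 ≤ |α| ≤ r`
      (∀ φ ∈ IsManifold.maximalAtlas (𝓡 m) ∞ M,
        ∃ e : Bundle.Trivialization (JetModel m r)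
            (Bundle.TotalSpace.proj :
              Bundle.TotalSpace (JetModel m r) (fun p : M => JetFiber m r p) → M),
          MemTrivializationAtlas e ∧ e.baseSet = φ.source ∧
          ∀ p ∈ φ.source, ∀ (ξ : JetFiber m r p) (α : JetIndex m r) (f : C^∞⟮𝓡 m, M; ℝ⟯),
            (∀ᶠ q in 𝓝 p, f q = ∏ i, (φ q i) ^ (α.1 i : ℕ)) → (e ⟨p, ξ⟩).2 α = ξ.act f) ∧
      -- smooth sections correspond linearly and bijectively to derivations of order `≤ r`
      ∃ Φ : ContMDiffSection (𝓡 m) (JetModel m r) ∞ (fun p : M => JetFiber m r p) ≃ₗ[ℝ]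
          higherDerivations ℝ C^∞⟮𝓡 m, M; ℝ⟯ r,
        ∀ (s : ContMDiffSection (𝓡 m) (JetModel m r) ∞ (fun p : M => JetFiber m r p))
          (f : C^∞⟮𝓡 m, M; ℝ⟯) (p : M),
          (Φ s : C^∞⟮𝓡 m, M; ℝ⟯ →ₗ[ℝ] C^∞⟮𝓡 m, M; ℝ⟯) f p = (s p).act f :=
  ⟨jetTotalSpaceTopology m M r, jetFiberTopology m M r, jetFiberBundle m M r, jetVectorBundle,
    jetContMDiffVectorBundle, fun _ hφ => exists_trivialization_of_mem_maximalAtlas r hφ,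
    jetSectionEquiv m M r, jetSectionToDerivation_apply⟩
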